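/- Let $S=(s_1,\dots,s_m)\in[n]^m$ be an access sequence over the keys $[n]=\{1,\dots,n\}$, where $n\ge 1$ and $m\ge 0$, and let $k\ge 1$. The sequence $S$ contains a permutation pattern $\pi$ of length $j$ if it has a subsequence of length $j$ that is order-isomorphic to $\pi$ (the subsequence's entries are then distinct); otherwise it avoids $\pi$. *$k$-lazy finger bound.* For a binary search tree $T$ with key set $[n]$, a strategy with $k$ fingers consists of an initial position $\ell_i\in[n]$ for each finger $i\in[k]$ and, for each $t\in\{1,\dots,m\}$, a finger $f_t\in[k]$, which moves to $s_t$ in order to serve the $t$-th request. Its cost is $\sum_{t=1}^m\bigl(1+d_T(s_t,p_t)\bigr)$, where $p_t$ is the position of finger $f_t$ just before request $t$ and $d_T$ is the distance in the tree $T$. Let $LF^k(S)$ be the minimum cost over all $T$ and all strategies. *Offline optimum.* In the dynamic BST model one chooses an initial binary search tree with key set $[n]$. Each access starts with a pointer at the root (cost $1$); each operation (moving the pointer to a child or to the parent of its node, or rotating the node at the pointer with its parent) costs $1$; during the $t$-th access the pointer has to visit the node with key $s_t$. Let $\mathrm{OPT}(S)$ be the minimum total cost of executing $S$, the whole sequence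 being known in advance. **Theorem.** There is an absolute constant $C>0$ such that for all $n\ge 1$, $m\ge 0$, $k\ge 1$ and every $S\in[n]^m$ that avoids $(1,2,\dots,k+1)$ or avoids $(k+1,\dots,2,1)$, $$LF^k(S)\le C\,m\,k\qquad\text{and}\qquad \mathrm{OPT}(S)\le C\,m\,k\log(k+1).$$ In particular $\mathrm{OPT}(S)=O(|S|\,k\log k)$ for $k\ge 2$. -/

import Mathlib

/-! Access sequences on the key set `[n]` are functions `S : Fin m → Fin n`. -/

namespace BSTModel

/-- `S` contains the pattern `π`: some subsequence of `S` is order-isomorphic to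
`(π 0, …, π (j - 1))`. -/
def ContainsPattern {n m j : ℕ} (S : Fin m → Fin n) (π : Equiv.Perm (Fin j)) : Prop :=
  ∃ g : Fin j → Fin m, StrictMono g ∧ ∀ a b : Fin j, S (g a) < S (g b) ↔ π a < π b

/-- `S` avoids the pattern `π`. -/
def AvoidsPattern {n m j : ℕ} (S : Fin m → Fin n) (π : Equiv.Perm (Fin j)) : Prop :=
  ¬ ContainsPattern S π

/-- The pattern `(1, 2, …, j)`. -/
def incPattern (j : ℕ) : Equiv.Perm (Fin j) := Equiv.refl (Fin j)

/-- The pattern `(j, …, 2, 1)`. -/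
def decPattern (j : ℕ) : Equiv.Perm (Fin j) := Fin.revPerm

/-- `Mem x T`: the key `x` is stored in the tree `T`. -/
def Mem {α : Type} (x : α) : BinaryTree α → Prop
  | .nil => False
  | .node y l r => x = y ∨ Mem x l ∨ Mem x r

/-- The search-tree property: at every node, the keys of the left subtree are smaller and the keys
of the right subtree are larger than the key of the node. -/
def IsSearchTree {α : Type} [LT α] : BinaryTree α → Prop
  | .nil => True
  | .node x l r =>
      (∀ y, Mem y l → y < x) ∧ (∀ y, Mem y r → x < y) ∧ IsSearchTree l ∧ IsSearchTree r

/-- `T` is a binary search tree on the key set `[n]`. -/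
def IsBSTOn (n : ℕ) (T : BinaryTree (Fin n)) : Prop :=
  IsSearchTree T ∧ ∀ x : Fin n, Mem x T

/-- `IsRoot T r`: the root of `T` holds the key `r`. -/
def IsRoot {α : Type} : BinaryTree α → α → Prop
  | .nil, _ => False
  | .node x _ _, r => r = x

/-- `IsChild T p c`: in `T`, the node with key `c` is a child of the node with key `p`. -/
def IsChild {α : Type} : BinaryTree α → α → α → Prop
  | .nil, _, _ => False
  | .node x l r, p, c =>
      (p = x ∧ (IsRoot l c ∨ IsRoot r c)) ∨ IsChild l p c ∨ IsChild r p c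

/-- The tree `T` as an undirected graph on its keys. -/
def treeGraph {α : Type} (T : BinaryTree α) : SimpleGraph α :=
  SimpleGraph.fromRel (IsChild T)

/-- The distance `d_T(x, y)` between two keys in the tree `T` (number of edges on the path). -/
noncomputable def treeDist {α : Type} (T : BinaryTree α) (x y : α) : ℕ∞ :=
  (treeGraph T).edist x y

/-! ### The `k`-lazy finger bound -/

/-- `fingerPos S f ℓ t i` is the position of finger `i` after the first `t` requests of `S` have been
served, where finger `f j` serves request `j` and `ℓ` is the vector of initial positions. -/
def fingerPos {n m k : ℕ} (S : Fin m → Fin n) (f : Fin m → Fin k) (ℓ : Fin k → Fin n) :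
    ℕ → Fin k → Fin n
  | 0, i => ℓ i
  | t + 1, i =>
      if h : t < m then
        if f ⟨t, h⟩ = i then S ⟨t, h⟩ else fingerPos S f ℓ t i
      else fingerPos S f ℓ t i

/-- The cost of the finger strategy `(f, ℓ)` for serving `S` in the reference tree `T`. -/
noncomputable def lazyFingerCost {n m k : ℕ} (T : BinaryTree (Fin n)) (S : Fin m → Fin n)
    (f : Fin m → Fin k) (ℓ : Fin k → Fin n) : ℕ∞ :=
  ∑ t : Fin m, (1 + treeDist T (S t) (fingerPos S f ℓ (t : ℕ) (f t)))

/-- The `k`-lazy finger bound: the minimum of the cost over all binary search trees on `[n]` and all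
strategies with `k` fingers. -/
noncomputable def LF {n m : ℕ} (k : ℕ) (S : Fin m → Fin n) : ℕ∞ :=
  ⨅ (T : BinaryTree (Fin n)) (_ : IsBSTOn n T) (f : Fin m → Fin k) (ℓ : Fin k → Fin n),
    lazyFingerCost T S f ℓ

/-! ### The dynamic BST model and the offline optimum -/

/-- `Rotate T x T'`: `T'` arises from `T` by rotating the node with key `x` with its parent. -/
inductive Rotate {α : Type} : BinaryTree α → α → BinaryTree α → Prop
  | right (x y : α) (A B C : BinaryTree α) :
      Rotate (.node y (.node x A B) C) x (.node x A (.node y B C))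
  | left (x y : α) (A B C : BinaryTree α) :
      Rotate (.node x A (.node y B C)) y (.node y (.node x A B) C)
  | inLeft (x z : α) (l l' r : BinaryTree α) :
      Rotate l x l' → Rotate (.node z l r) x (.node z l' r)
  | inRight (x z : α) (l r r' : BinaryTree α) :
      Rotate r x r' → Rotate (.node z l r) x (.node z l r')

/-- One unit-cost operation on a tree with a pointer, the pointer being given by the key of its node:
move the pointer to a child, move it to the parent, or rotate its node with the parent. -/
inductive Step {α : Type} : BinaryTree α × α → BinaryTree α × α → Prop
  | down (T : BinaryTree α) (p c : α) : IsChild T p c → Step (T, p) (T, c)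
  | up (T : BinaryTree α) (p c : α) : IsChild T p c → Step (T, c) (T, p)
  | rotate (T T' : BinaryTree α) (x : α) : Rotate T x T' → Step (T, x) (T', x)

/-- `Run c s s'`: the state `s'` is reached from `s` by exactly `c` unit-cost operations. -/
inductive Run {α : Type} : ℕ → BinaryTree α × α → BinaryTree α × α → Prop
  | refl (s : BinaryTree α × α) : Run 0 s s
  | tail (c : ℕ) (s s' s'' : BinaryTree α × α) : Run c s s' → Step s' s'' → Run (c + 1) s s''

/-- `Access T x c T'`: starting with the pointer at the root of `T`, the key `x` is accessed and the
tree is turned into `T'` at total cost `c`. Placing the pointer at the root costs `1`, each operation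
costs `1`, and the pointer has to be at `x` at some moment. -/
def Access {α : Type} (T : BinaryTree α) (x : α) (c : ℕ) (T' : BinaryTree α) : Prop :=
  ∃ (r p : α) (U : BinaryTree α) (c₁ c₂ : ℕ),
    IsRoot T r ∧ Run c₁ (T, r) (U, x) ∧ Run c₂ (U, x) (T', p) ∧ c = 1 + c₁ + c₂

/-- An execution of `S` in the BST model: `T t` is the tree before access `t`, the initial tree `T 0`
is an arbitrary binary search tree on `[n]`, and access `t` has cost `c t`. -/
def IsExecution {n m : ℕ} (S : Fin m → Fin n) (T : Fin (m + 1) → BinaryTree (Fin n))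
    (c : Fin m → ℕ) : Prop :=
  IsBSTOn n (T 0) ∧ ∀ t : Fin m, Access (T t.castSucc) (S t) (c t) (T t.succ)

/-- The optimal offline cost of executing `S` on a binary search tree with key set `[n]`. -/
noncomputable def OPT {n m : ℕ} (S : Fin m → Fin n) : ℕ∞ :=
  ⨅ (T : Fin (m + 1) → BinaryTree (Fin n)) (c : Fin m → ℕ) (_ : IsExecution S T c),
    ((∑ t : Fin m, c t : ℕ) : ℕ∞)

end BSTModel

/-! Patience sorting serves `S`: all fingers start at the largest key `w`, and a request goes to the
first finger that is not to its left. Fingers then only move left and stay ordered. A finger `j`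
that has left `w` certifies an increasing subsequence of length `j + 1` with values up to its
position (`exists_chain_of_finger_lt`), so avoiding `(1, …, k + 1)` makes the first `k` fingers
sufficient. The decreasing pattern reduces to this by reflecting the keys (`Schedule.rev`).

Lazy fingers: let `K` consist of `w` and the requested keys, and let the reference tree carry `K` on
its right spine. Serving a request then costs at most the number of keys of `K` that the finger
sweeps, endpoints included (`one_add_treeDist_spine_le`). A finger that only moves left sweeps at
most `|K| + m` keys in total (`sum_card_pathRow_le`), which sums to `3mk`.

Offline optimum: in the time-key plane the fingers trace descending staircases. One further
staircase between each neighbouring pair (`bounce`) makes the union arborally satisfied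
(`satisfied_interleave`) with at most `6mk` touches. A satisfied set becomes an execution
(`OPT_le_of_satisfied`) by keeping a Cartesian tree ordered by next touch, with ties going to the
more recently touched key. The keys touched in row `t` form a top part of the tree both before and
after access `t`, and the subtrees below are unchanged. Rebuilding the top part through a common
right spine costs time linear in its size.

This gives `OPT S = O(mk)` without a logarithm, which is stronger than the bound asked for. -/

namespace BSTModel

/-! ### Runs -/

theorem Run.trans {α : Type} {c d : ℕ} {s s' s'' : BinaryTree α × α} (h : Run c s s')
    (h' : Run d s' s'') : Run (c + d) s s'' := by
  induction h' with
  | refl => exact h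
  | tail d _ _ _ _ hs ih => exact Run.tail _ _ _ _ (ih h) hs

theorem Step.run {α : Type} {s s' : BinaryTree α × α} (h : Step s s') : Run 1 s s' :=
  Run.tail 0 _ _ _ (Run.refl _) h

theorem Run.inRight {α : Type} {c : ℕ} {s s' : BinaryTree α × α} (z : α) (l : BinaryTree α)
    (h : Run c s s') : Run c (.node z l s.1, s.2) (.node z l s'.1, s'.2) := by
  induction h with
  | refl => exact Run.refl _
  | tail d _ _ _ _ hs ih =>
    refine Run.tail _ _ _ _ ih ?_
    cases hs with
    | down T p c h => exact Step.down _ _ _ (Or.inr (Or.inr h))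
    | up T p c h => exact Step.up _ _ _ (Or.inr (Or.inr h))
    | rotate T T' x h => exact Step.rotate _ _ _ (Rotate.inRight _ _ _ _ _ h)

theorem isRoot_node {α : Type} (a : α) (l r : BinaryTree α) : IsRoot (.node a l r) a :=
  rfl

theorem IsRoot.isChild_left {α : Type} {a c : α} {l r : BinaryTree α} (h : IsRoot l c) :
    IsChild (.node a l r) a c :=
  Or.inl ⟨rfl, Or.inl h⟩

theorem IsRoot.isChild_right {α : Type} {a c : α} {l r : BinaryTree α} (h : IsRoot r c) :
    IsChild (.node a l r) a c :=
  Or.inl ⟨rfl, Or.inr h⟩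

/-- A rotation is undone by rotating the old parent, which has become a child. -/
theorem Rotate.exists_inverse {α : Type} {T T' : BinaryTree α} {x : α} (h : Rotate T x T') :
    ∃ y, IsChild T' x y ∧ Rotate T' y T ∧ IsChild T y x := by
  induction h with
  | right x y A B C =>
    exact ⟨y, Or.inl ⟨rfl, Or.inr rfl⟩, Rotate.left _ _ _ _ _, Or.inl ⟨rfl, Or.inl rfl⟩⟩
  | left x y A B C =>
    exact ⟨x, Or.inl ⟨rfl, Or.inl rfl⟩, Rotate.right _ _ _ _ _, Or.inl ⟨rfl, Or.inr rfl⟩⟩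
  | inLeft x z l l' r _ ih =>
    obtain ⟨y, h1, h2, h3⟩ := ih
    exact ⟨y, Or.inr (Or.inl h1), Rotate.inLeft _ _ _ _ _ h2, Or.inr (Or.inl h3)⟩
  | inRight x z l l' r _ ih =>
    obtain ⟨y, h1, h2, h3⟩ := ih
    exact ⟨y, Or.inr (Or.inr h1), Rotate.inRight _ _ _ _ _ h2, Or.inr (Or.inr h3)⟩

/-- Undoing a rotation takes three operations: move down to the old parent, rotate it back up, and
return to the rotated node. -/
theorem Step.reverse {α : Type} {s s' : BinaryTree α × α} (h : Step s s') :
    ∃ c ≤ 3, Run c s' s := by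
  cases h with
  | down T p c h => exact ⟨1, by norm_num, (Step.up _ _ _ h).run⟩
  | up T p c h => exact ⟨1, by norm_num, (Step.down _ _ _ h).run⟩
  | rotate T T' x h =>
    obtain ⟨y, h1, h2, h3⟩ := h.exists_inverse
    exact ⟨3, le_rfl, ((Step.down _ _ _ h1).run.trans (Step.rotate _ _ _ h2).run).trans
      (Step.down _ _ _ h3).run⟩

theorem Run.reverse {α : Type} {c : ℕ} {s s' : BinaryTree α × α} (h : Run c s s') :
    ∃ d ≤ 3 * c, Run d s' s := by
  induction h with
  | refl => exact ⟨0, by norm_num, Run.refl _⟩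
  | tail d _ _ _ _ hs ih =>
    obtain ⟨e, he, hr⟩ := ih
    obtain ⟨e', he', hr'⟩ := hs.reverse
    exact ⟨e' + e, by omega, hr'.trans hr⟩

/-! ### Straightening the top part of a tree -/

/-- The right spine with the given keys and left subtrees, ending in the tree `g`. -/
def spine {α : Type} : List (BinaryTree α × α) → BinaryTree α → BinaryTree α
  | [], g => g
  | (h, a) :: s, g => .node a h (spine s g)

/-- The key of the first node of a spine, with a default. -/
def spineHead {α : Type} : List (BinaryTree α × α) → α → α
  | [], z => z
  | (_, a) :: _, _ => a

/-- The keys of the top part of `T` with keys in `X` in symmetric order, each with the subtree hanging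
off to its left, and the last hanging subtree. -/
def straighten {α : Type} [DecidableEq α] (X : Finset α) :
    BinaryTree α → List (BinaryTree α × α) × BinaryTree α
  | .nil => ([], .nil)
  | .node a A B =>
      if a ∈ X then
        ((straighten X A).1 ++ ((straighten X A).2, a) :: (straighten X B).1, (straighten X B).2)
      else ([], .node a A B)

theorem spine_append {α : Type} (s s' : List (BinaryTree α × α)) (g : BinaryTree α) :
    spine (s ++ s') g = spine s (spine s' g) := by
  induction s with
  | nil => rfl
  | cons p s ih => simp [spine, ih]

theorem spineHead_append_cons {α : Type} (s s' : List (BinaryTree α × α)) (g : BinaryTree α)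
    (a z : α) : spineHead (s ++ (g, a) :: s') z = spineHead s a := by
  cases s <;> rfl

theorem isRoot_spine_append {α : Type} (s s' : List (BinaryTree α × α)) (g r : BinaryTree α)
    (a : α) : IsRoot (spine (s ++ (g, a) :: s') r) (spineHead s a) := by
  cases s <;> rfl

/-- With the pointer at `z`, the left child `a` is rotated above `z`; its right subtree becomes the
left subtree of `z` and is straightened there, then the left subtree of `a` is treated in the same
way with `a` as `z`. Each node of the top part costs four operations: down, rotate, down, up. -/
theorem run_straighten_left {α : Type} [DecidableEq α] (X : Finset α) (T : BinaryTree α) :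
    ∀ (z : α) (r : BinaryTree α), Run (4 * (straighten X T).1.length) (.node z T r, z)
      (spine ((straighten X T).1 ++ [((straighten X T).2, z)]) r,
        spineHead (straighten X T).1 z) := by
  induction T with
  | nil => intro z r; exact Run.refl _
  | node a A B ihA ihB =>
    intro z r
    by_cases ha : a ∈ X
    · have h1 : Run 1 (.node z (.node a A B) r, z) (.node z (.node a A B) r, a) :=
        (Step.down _ _ _ (IsRoot.isChild_left (isRoot_node _ _ _))).run
      have h2 : Run 1 (.node z (.node a A B) r, a) (.node a A (.node z B r), a) :=
        (Step.rotate _ _ _ (Rotate.right _ _ _ _ _)).run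
      have h3 : Run 1 (.node a A (.node z B r), a) (.node a A (.node z B r), z) :=
        (Step.down _ _ _ (IsRoot.isChild_right (isRoot_node _ _ _))).run
      have h4 := (ihB z r).inRight a A
      have h5 : Run 1 (.node a A (spine ((straighten X B).1 ++ [((straighten X B).2, z)]) r),
          spineHead (straighten X B).1 z)
          (.node a A (spine ((straighten X B).1 ++ [((straighten X B).2, z)]) r), a) :=
        (Step.up _ _ _ (isRoot_spine_append _ _ _ _ _).isChild_right).run
      have h6 := ihA a (spine ((straighten X B).1 ++ [((straighten X B).2, z)]) r)
      have h := ((((h1.trans h2).trans h3).trans h4).trans h5).trans h6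
      simp only [straighten, ha, if_true, spineHead_append_cons]
      rw [← spine_append] at h
      convert h using 1
      · simp only [List.length_append, List.length_cons]; ring
      · simp
    · simp only [straighten, ha, if_false]
      exact Run.refl _

/-- The right subtree of the root is straightened first, with one move down and one back up; then
`run_straighten_left` flattens the left subtree onto the spine. -/
theorem run_straighten {α : Type} [DecidableEq α] (X : Finset α) (T : BinaryTree α) :
    ∀ r ∈ X, IsRoot T r → ∃ c ≤ 4 * (straighten X T).1.length,
      Run c (T, r) (spine (straighten X T).1 (straighten X T).2,
        spineHead (straighten X T).1 r) := by
  induction T with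
  | nil => intro r _ h; exact h.elim
  | node a A B _ ihB =>
    rintro r hr (rfl : r = a)
    have key : ∃ c ≤ 2 + 4 * (straighten X B).1.length, Run c (.node r A B, r)
        (.node r A (spine (straighten X B).1 (straighten X B).2), r) := by
      cases B with
      | nil => exact ⟨0, by omega, Run.refl _⟩
      | node b B₁ B₂ =>
        by_cases hb : b ∈ X
        · obtain ⟨c, hc, hrun⟩ := ihB b hb rfl
          refine ⟨1 + c + 1, by omega,
            ((Step.down _ _ b (IsRoot.isChild_right (isRoot_node _ _ _))).run.trans
            (hrun.inRight r A)).trans (Step.up _ _ _ (IsRoot.isChild_right ?_)).run⟩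
          simp only [straighten, hb, if_true, spineHead_append_cons]
          exact isRoot_spine_append _ _ _ _ _
        · exact ⟨0, by omega, by simpa [straighten, hb, spine] using Run.refl _⟩
    obtain ⟨c, hc, hrun⟩ := key
    have h := hrun.trans (run_straighten_left X A r _)
    rw [← spine_append] at h
    refine ⟨c + 4 * (straighten X A).1.length, ?_, ?_⟩
    · simp only [straighten, hr, if_true, List.length_append, List.length_cons]
      omega
    · simp only [straighten, hr, if_true, spineHead_append_cons]
      simpa using h

theorem run_spine {α : Type} (s : List (BinaryTree α × α)) (g : BinaryTree α) :
    ∀ x ∈ s.map Prod.snd, ∀ z, ∃ c ≤ s.length, Run c (spine s g, spineHead s z) (spine s g, x) := by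
  induction s with
  | nil => simp
  | cons p s ih =>
    obtain ⟨h, a⟩ := p
    intro x hx z
    by_cases hxa : x = a
    · subst hxa
      exact ⟨0, by omega, Run.refl _⟩
    · have hx' : x ∈ s.map Prod.snd := by simpa [hxa] using hx
      obtain ⟨c, hc, hrun⟩ := ih x hx' z
      refine ⟨1 + c, by simp only [List.length_cons]; omega,
        (Step.down _ _ _ (IsRoot.isChild_right ?_)).run.trans (hrun.inRight a h)⟩
      cases s with
      | nil => simp at hx'
      | cons q s => rfl

/-- Two trees with the same straightening are turned into each other in time linear in the size of
the top part, and every key of the top part can be accessed on the way. -/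
theorem access_of_straighten_eq {α : Type} [DecidableEq α] (X : Finset α) (T T' : BinaryTree α)
    (h : straighten X T = straighten X T') (r r' : α) (hr : r ∈ X) (hr' : r' ∈ X)
    (hT : IsRoot T r) (hT' : IsRoot T' r') (x : α) (hx : x ∈ (straighten X T).1.map Prod.snd) :
    ∃ c ≤ 21 * (straighten X T).1.length, Access T x c T' := by
  obtain ⟨c₁, hc₁, h₁⟩ := run_straighten X T r hr hT
  obtain ⟨c₂, hc₂, h₂⟩ := run_straighten X T' r' hr' hT'
  rw [← h] at h₂ hc₂
  obtain ⟨d, hd, hrun⟩ := run_spine (straighten X T).1 (straighten X T).2 x hx r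
  obtain ⟨d', hd', hrun'⟩ := hrun.reverse
  obtain ⟨e, he, hrev⟩ := h₂.reverse
  have hpos : 0 < (straighten X T).1.length := by
    have := List.length_pos_of_mem hx
    simpa using this
  have hhead : spineHead (straighten X T).1 r' = spineHead (straighten X T).1 r := by
    cases hs : (straighten X T).1 with
    | nil => simp [hs] at hpos
    | cons p s => rfl
  rw [hhead] at hrev
  -- With `L ≥ 1` spine nodes, the cost is at most `1 + 4L + L` to reach `x` on the spine, and
  -- reversing costs a factor 3: `3L` to return to the head, `12L` to build `T'`. The sum `1 + 20L`
  -- is at most `21L`.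
  exact ⟨1 + (c₁ + d) + (d' + e), by omega, r, r', _, c₁ + d, d' + e, hT, h₁.trans hrun,
    hrun'.trans hrev, rfl⟩

/-! ### Cartesian trees -/

/-- Insertion of a key to the left of all keys of a heap-ordered tree. -/
def insertMin {α β : Type} [LinearOrder β] (pr : α → β) (a : α) : BinaryTree α → BinaryTree α
  | .nil => .node a .nil .nil
  | .node b l r =>
      if pr a ≤ pr b then .node a .nil (.node b l r) else .node b (insertMin pr a l) r

/-- The heap-ordered tree with the given list of keys in symmetric order. -/
def cart {α β : Type} [LinearOrder β] (pr : α → β) : List α → BinaryTree α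
  | [] => .nil
  | a :: l => insertMin pr a (cart pr l)

theorem mem_insertMin {α β : Type} [LinearOrder β] (pr : α → β) (a x : α) (T : BinaryTree α) :
    Mem x (insertMin pr a T) ↔ x = a ∨ Mem x T := by
  induction T with
  | nil => simp [insertMin, Mem]
  | node b l r ihl _ =>
    unfold insertMin
    split_ifs
    · simp [Mem]
    · simp only [Mem, ihl]; tauto

theorem mem_cart {α β : Type} [LinearOrder β] (pr : α → β) (x : α) (l : List α) :
    Mem x (cart pr l) ↔ x ∈ l := by
  induction l with
  | nil => simp [cart, Mem]
  | cons a l ih => simp [cart, mem_insertMin, ih]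

theorem isSearchTree_insertMin {α β : Type} [LinearOrder α] [LinearOrder β] (pr : α → β) (a : α)
    (T : BinaryTree α) (hT : IsSearchTree T) (h : ∀ y, Mem y T → a < y) :
    IsSearchTree (insertMin pr a T) := by
  induction T with
  | nil => simp [insertMin, IsSearchTree, Mem]
  | node b l r ihl _ =>
    unfold insertMin
    split_ifs
    · exact ⟨by simp [Mem], h, trivial, hT⟩
    · obtain ⟨h1, h2, h3, h4⟩ := hT
      refine ⟨fun y hy => ?_, h2, ihl h3 fun y hy => h y (Or.inr (Or.inl hy)), h4⟩
      rcases (mem_insertMin pr a y l).1 hy with rfl | hy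
      · exact h b (Or.inl rfl)
      · exact h1 y hy

theorem isSearchTree_cart {α β : Type} [LinearOrder α] [LinearOrder β] (pr : α → β) (l : List α)
    (hl : l.Pairwise (· < ·)) : IsSearchTree (cart pr l) := by
  induction l with
  | nil => trivial
  | cons a l ih =>
    obtain ⟨h1, h2⟩ := List.pairwise_cons.1 hl
    exact isSearchTree_insertMin _ _ _ (ih h2) fun y hy => h1 y ((mem_cart _ _ _).1 hy)

theorem isBSTOn_cart {n : ℕ} {β : Type} [LinearOrder β] (pr : Fin n → β) :
    IsBSTOn n (cart pr (List.finRange n)) :=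
  ⟨isSearchTree_cart _ _ (List.pairwise_lt_finRange n),
    fun x => (mem_cart _ _ _).2 (List.mem_finRange x)⟩

theorem insertMin_congr {α β : Type} [LinearOrder β] {pr pr' : α → β} {a : α} {T : BinaryTree α}
    (ha : pr a = pr' a) (h : ∀ x, Mem x T → pr x = pr' x) :
    insertMin pr a T = insertMin pr' a T := by
  induction T with
  | nil => rfl
  | node b l r ihl _ =>
    simp only [insertMin, ha, h b (Or.inl rfl), ihl fun x hx => h x (Or.inr (Or.inl hx))]

theorem cart_congr {α β : Type} [LinearOrder β] {pr pr' : α → β} {l : List α}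
    (h : ∀ x ∈ l, pr x = pr' x) : cart pr l = cart pr' l := by
  induction l with
  | nil => rfl
  | cons a l ih =>
    simp only [cart]
    rw [ih fun x hx => h x (List.mem_cons_of_mem _ hx)]
    exact insertMin_congr (h a List.mem_cons_self) fun x hx =>
      h x (List.mem_cons_of_mem _ ((mem_cart _ _ _).1 hx))

/-- The leftmost key of minimal priority is the root, because `insertMin` lets the new left key win
ties. -/
theorem cart_append_cons {α β : Type} [LinearOrder β] (pr : α → β) (l₁ l₂ : List α) (b : α)
    (h₁ : ∀ x ∈ l₁, pr b < pr x) (h₂ : ∀ x ∈ l₂, pr b ≤ pr x) :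
    cart pr (l₁ ++ b :: l₂) = .node b (cart pr l₁) (cart pr l₂) := by
  induction l₁ with
  | nil =>
    simp only [List.nil_append, cart]
    cases h : cart pr l₂ with
    | nil => rfl
    | node c l r =>
      have hc : c ∈ l₂ := (mem_cart pr c l₂).1 (by rw [h]; exact Or.inl rfl)
      simp [insertMin, h₂ c hc]
  | cons c l₁ ih =>
    simp only [List.cons_append, cart]
    rw [ih fun x hx => h₁ x (List.mem_cons_of_mem _ hx)]
    simp [insertMin, h₁ c List.mem_cons_self]

theorem exists_split_min {α β : Type} [LinearOrder β] (pr : α → β) (l : List α) (hl : l ≠ []) :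
    ∃ l₁ b l₂, l = l₁ ++ b :: l₂ ∧ (∀ x ∈ l₁, pr b < pr x) ∧ ∀ x ∈ l₂, pr b ≤ pr x := by
  induction l with
  | nil => exact absurd rfl hl
  | cons a l ih =>
    by_cases hn : l = []
    · exact ⟨[], a, [], by simp [hn], by simp, by simp⟩
    · obtain ⟨l₁, b, l₂, rfl, h₁, h₂⟩ := ih hn
      rcases le_or_gt (pr a) (pr b) with hab | hab
      · refine ⟨[], a, l₁ ++ b :: l₂, rfl, by simp, fun x hx => ?_⟩
        rcases List.mem_append.1 hx with hx | hx
        · exact hab.trans (h₁ x hx).le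
        · rcases List.mem_cons.1 hx with rfl | hx
          · exact hab
          · exact hab.trans (h₂ x hx)
      · refine ⟨a :: l₁, b, l₂, rfl, fun x hx => ?_, h₂⟩
        rcases List.mem_cons.1 hx with rfl | hx
        · exact hab
        · exact h₁ x hx

/-- The straightening that a Cartesian tree has if its keys in `X` form a top part. -/
def gaps {α β : Type} [DecidableEq α] [LinearOrder β] (pr : α → β) (X : Finset α) :
    List α → List α → List (BinaryTree α × α) × BinaryTree α
  | acc, [] => ([], cart pr acc)
  | acc, a :: l =>
      if a ∈ X then ((cart pr acc, a) :: (gaps pr X [] l).1, (gaps pr X [] l).2)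
      else gaps pr X (acc ++ [a]) l

theorem gaps_append_cons {α β : Type} [DecidableEq α] [LinearOrder β] (pr : α → β) (X : Finset α)
    (l₁ l₂ : List α) (a : α) (ha : a ∈ X) : ∀ acc, gaps pr X acc (l₁ ++ a :: l₂) =
      ((gaps pr X acc l₁).1 ++ ((gaps pr X acc l₁).2, a) :: (gaps pr X [] l₂).1,
        (gaps pr X [] l₂).2) := by
  induction l₁ with
  | nil => simp [gaps, ha]
  | cons b l₁ ih =>
    intro acc
    by_cases hb : b ∈ X <;> simp [gaps, hb, ih]

theorem gaps_of_forall_notMem {α β : Type} [DecidableEq α] [LinearOrder β] (pr : α → β)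
    (X : Finset α) (l : List α) (h : ∀ x ∈ l, x ∉ X) :
    ∀ acc, gaps pr X acc l = ([], cart pr (acc ++ l)) := by
  induction l with
  | nil => simp [gaps]
  | cons b l ih =>
    intro acc
    simp [gaps, h b List.mem_cons_self, ih fun x hx => h x (List.mem_cons_of_mem _ hx)]

/-- Only the blocks of keys outside `X` enter as Cartesian trees. This is why the trees before and
after an access have the same straightening. -/
theorem gaps_congr {α β : Type} [DecidableEq α] [LinearOrder β] {pr pr' : α → β} {X : Finset α}
    (h : ∀ x ∉ X, pr x = pr' x) (l : List α) :
    ∀ acc : List α, (∀ x ∈ acc, x ∉ X) → gaps pr X acc l = gaps pr' X acc l := by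
  induction l with
  | nil => intro acc hacc; simp [gaps, cart_congr fun x hx => h x (hacc x hx)]
  | cons b l ih =>
    intro acc hacc
    by_cases hb : b ∈ X
    · simp [gaps, hb, ih [] (by simp), cart_congr fun x hx => h x (hacc x hx)]
    · simp only [gaps, hb, if_false]
      refine ih _ fun x hx => ?_
      rcases List.mem_append.1 hx with hx | hx
      · exact hacc x hx
      · rwa [List.mem_singleton.1 hx]

theorem map_snd_gaps {α β : Type} [DecidableEq α] [LinearOrder β] (pr : α → β) (X : Finset α)
    (l : List α) : ∀ acc, (gaps pr X acc l).1.map Prod.snd = l.filter (· ∈ X) := by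
  induction l with
  | nil => simp [gaps]
  | cons b l ih =>
    intro acc
    by_cases hb : b ∈ X <;> simp [gaps, hb, ih]

theorem straighten_of_forall_notMem {α : Type} [DecidableEq α] (X : Finset α) (T : BinaryTree α)
    (h : ∀ x, Mem x T → x ∉ X) : straighten X T = ([], T) := by
  cases T with
  | nil => rfl
  | node a A B => simp [straighten, h a (Or.inl rfl)]

/-- On a sorted interval of keys, the keys in `X` form a top part of the Cartesian tree if no key
outside `X` has minimal priority in an interval that meets `X`. -/
theorem straighten_cart {α β : Type} [LinearOrder α] [LinearOrder β] (pr : α → β) (X : Finset α)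
    (hX : ∀ x ∈ X, ∀ y ∉ X, ∃ z ∈ Set.uIcc x y, pr z < pr y) :
    ∀ (N : ℕ) (l : List α), l.length = N → l.Pairwise (· < ·) →
      (∀ x ∈ l, ∀ y ∈ l, ∀ z ∈ Set.uIcc x y, z ∈ l) →
      straighten X (cart pr l) = gaps pr X [] l := by
  intro N
  induction N using Nat.strong_induction_on with
  | _ N ih =>
  intro l hN hl hc
  by_cases hex : ∀ x ∈ l, x ∉ X
  · rw [gaps_of_forall_notMem pr X l hex, straighten_of_forall_notMem]
    · rfl
    · exact fun x hx => hex x ((mem_cart _ _ _).1 hx)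
  · push Not at hex
    obtain ⟨x, hx, hxX⟩ := hex
    obtain ⟨l₁, b, l₂, rfl, h₁, h₂⟩ := exists_split_min pr l (List.ne_nil_of_mem hx)
    -- If the root of this interval were outside `X`, `hX` would give a key between it and `x`,
    -- hence in the interval, of smaller priority.
    have hb : b ∈ X := by
      by_contra hb
      obtain ⟨z, hz, hzb⟩ := hX x hxX b hb
      have hzl := hc x hx b (by simp) z hz
      rcases List.mem_append.1 hzl with h | h
      · exact absurd hzb (h₁ z h).not_gt
      · rcases List.mem_cons.1 h with rfl | h
        · exact lt_irrefl _ hzb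
        · exact absurd hzb (h₂ z h).not_gt
    obtain ⟨p₁, p₂, p₃⟩ := List.pairwise_append.1 hl
    obtain ⟨p₄, p₅⟩ := List.pairwise_cons.1 p₂
    have hlen : l₁.length + (l₂.length + 1) = N := by simpa using hN
    have e₁ := ih l₁.length (by omega) l₁ rfl p₁ (by
      intro x hx y hy z hz
      have hzb : z < b := by
        rcases Set.mem_uIcc.1 hz with h | h
        · exact h.2.trans_lt (p₃ y hy b List.mem_cons_self)
        · exact h.2.trans_lt (p₃ x hx b List.mem_cons_self)
      rcases List.mem_append.1 (hc x (by simp [hx]) y (by simp [hy]) z hz) with h | h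
      · exact h
      · rcases List.mem_cons.1 h with rfl | h
        · exact absurd hzb (lt_irrefl _)
        · exact absurd hzb (p₄ z h).not_gt)
    have e₂ := ih l₂.length (by omega) l₂ rfl p₅ (by
      intro x hx y hy z hz
      have hzb : b < z := by
        rcases Set.mem_uIcc.1 hz with h | h
        · exact (p₄ x hx).trans_le h.1
        · exact (p₄ y hy).trans_le h.1
      rcases List.mem_append.1 (hc x (by simp [hx]) y (by simp [hy]) z hz) with h | h
      · exact absurd hzb (p₃ z h b List.mem_cons_self).not_gt
      · rcases List.mem_cons.1 h with rfl | h
        · exact absurd hzb (lt_irrefl _)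
        · exact h)
    rw [cart_append_cons pr l₁ l₂ b h₁ h₂, gaps_append_cons pr X l₁ l₂ b hb]
    simp [straighten, hb, e₁, e₂]

theorem exists_isRoot_cart {n : ℕ} {β : Type} [LinearOrder β] (pr : Fin n → β)
    (X : Finset (Fin n)) (hX : ∀ x ∈ X, ∀ y ∉ X, ∃ z ∈ Set.uIcc x y, pr z < pr y)
    (hne : X.Nonempty) : ∃ r ∈ X, IsRoot (cart pr (List.finRange n)) r := by
  obtain ⟨x, hx⟩ := hne
  obtain ⟨l₁, b, l₂, hl, h₁, h₂⟩ := exists_split_min pr (List.finRange n)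
    (List.ne_nil_of_mem (List.mem_finRange x))
  refine ⟨b, ?_, ?_⟩
  · by_contra hb
    obtain ⟨z, -, hz⟩ := hX x hx b hb
    have hzl := List.mem_finRange z
    rw [hl] at hzl
    rcases List.mem_append.1 hzl with h | h
    · exact absurd hz (h₁ z h).not_gt
    · rcases List.mem_cons.1 h with rfl | h
      · exact lt_irrefl _ hz
      · exact absurd hz (h₂ z h).not_gt
  · rw [hl, cart_append_cons pr l₁ l₂ b h₁ h₂]
    rfl

/-- Changing the priorities of the keys in a common top part costs time linear in its size. -/
theorem access_cart {n : ℕ} {β : Type} [LinearOrder β] (pr pr' : Fin n → β) (X : Finset (Fin n))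
    (hX : ∀ x ∈ X, ∀ y ∉ X, ∃ z ∈ Set.uIcc x y, pr z < pr y)
    (hX' : ∀ x ∈ X, ∀ y ∉ X, ∃ z ∈ Set.uIcc x y, pr' z < pr' y)
    (h : ∀ x ∉ X, pr x = pr' x) (x : Fin n) (hx : x ∈ X) :
    ∃ c ≤ 21 * X.card,
      Access (cart pr (List.finRange n)) x c (cart pr' (List.finRange n)) := by
  obtain ⟨r, hr, hroot⟩ := exists_isRoot_cart pr X hX ⟨x, hx⟩
  obtain ⟨r', hr', hroot'⟩ := exists_isRoot_cart pr' X hX' ⟨x, hx⟩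
  have e := straighten_cart pr X hX _ (List.finRange n) rfl (List.pairwise_lt_finRange n)
    (by simp)
  have e' := straighten_cart pr' X hX' _ (List.finRange n) rfl (List.pairwise_lt_finRange n)
    (by simp)
  have hs := map_snd_gaps pr X (List.finRange n) []
  have hlen : (straighten X (cart pr (List.finRange n))).1.length = X.card := by
    rw [e, ← List.length_map (f := Prod.snd), hs,
      ← List.toFinset_card_of_nodup ((List.nodup_finRange n).filter _)]
    congr 1
    ext; simp
  have := access_of_straighten_eq X _ _
    (e.trans ((gaps_congr h _ [] (by simp)).trans e'.symm)) r r' hr hr' hroot hroot' x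
    (by rw [e, hs]; simp [hx])
  rwa [hlen] at this

/-- A family of touched key sets is arborally satisfied: the rectangle spanned by two touches in
different rows and columns contains a third touch. -/
def Satisfied {n : ℕ} (m : ℕ) (X : ℕ → Finset (Fin n)) : Prop :=
  ∀ t u, t < u → u < m → ∀ x ∈ X t, ∀ y ∈ X u, x ≠ y →
    ∃ v z, t ≤ v ∧ v ≤ u ∧ z ∈ X v ∧ z ∈ Set.uIcc x y ∧ ¬(v = t ∧ z = x) ∧ ¬(v = u ∧ z = y)

/-! ### Descending staircases -/

/-- The keys of `K` that a descending path passes in row `t`. -/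
def pathRow {n : ℕ} (K : Finset (Fin n)) (P : ℕ → Fin n) (t : ℕ) : Finset (Fin n) :=
  K.filter fun x => P (t + 1) ≤ x ∧ x ≤ P t

theorem mem_pathRow {n : ℕ} {K : Finset (Fin n)} {P : ℕ → Fin n} {t : ℕ} {x : Fin n} :
    x ∈ pathRow K P t ↔ x ∈ K ∧ P (t + 1) ≤ x ∧ x ≤ P t := by
  simp [pathRow]

theorem sum_card_pathRow_le {n : ℕ} (K : Finset (Fin n)) (P : ℕ → Fin n) (hP : Antitone P)
    (m : ℕ) : ∑ t ∈ Finset.range m, (pathRow K P t).card ≤ K.card + m := by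
  -- Row `t` adds keys not passed before, those in `(P (t + 1), P t]`, and at most the one further
  -- key `P (t + 1)`, which may be counted again later.
  have key : ∀ m, ∑ t ∈ Finset.range m, (pathRow K P t).card ≤
      (K.filter fun x => P m < x).card + m := by
    intro m
    induction m with
    | zero => simp
    | succ m ih =>
      rw [Finset.sum_range_succ]
      have h1 : pathRow K P m ⊆
          insert (P (m + 1)) (K.filter fun x => P (m + 1) < x ∧ x ≤ P m) := by
        intro x hx
        obtain ⟨h1, h2, h3⟩ := mem_pathRow.1 hx
        rcases h2.eq_or_lt with h | h
        · simp [h]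
        · simp [h1, h, h3]
      have h2 := (Finset.card_le_card h1).trans (Finset.card_insert_le _ _)
      have h3 : (K.filter fun x => P m < x).card +
          (K.filter fun x => P (m + 1) < x ∧ x ≤ P m).card ≤
          (K.filter fun x => P (m + 1) < x).card := by
        rw [← Finset.card_union_of_disjoint]
        · refine Finset.card_le_card fun x hx => ?_
          have := hP (Nat.le_succ m)
          simp only [Finset.mem_union, Finset.mem_filter] at hx ⊢
          rcases hx with hx | hx
          · exact ⟨hx.1, this.trans_lt hx.2⟩
          · exact ⟨hx.1, hx.2.1⟩
        · rw [Finset.disjoint_left]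
          intro x hx hx'
          simp only [Finset.mem_filter] at hx hx'
          exact absurd hx.2 hx'.2.2.not_gt
      omega
  exact (key m).trans (Nat.add_le_add_right (Finset.card_filter_le _ _) _)

/-- The rectangle with corners `(x, t)` and `(y, u)` contains a touch of `R` that is not one of these
two corners. -/
def HasTouch {n : ℕ} (R : ℕ → Finset (Fin n)) (x : Fin n) (t : ℕ) (y : Fin n) (u : ℕ) : Prop :=
  ∃ v z, t ≤ v ∧ v ≤ u ∧ z ∈ R v ∧ z ∈ Set.uIcc x y ∧ ¬(v = t ∧ z = x) ∧ ¬(v = u ∧ z = y)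

theorem HasTouch.mono {n : ℕ} {R R' : ℕ → Finset (Fin n)} (h : ∀ t, R t ⊆ R' t) {x y : Fin n}
    {t u : ℕ} : HasTouch R x t y u → HasTouch R' x t y u := by
  rintro ⟨v, z, h1, h2, h3, h4⟩
  exact ⟨v, z, h1, h2, h v h3, h4⟩

/-- Rectangles whose later corner is to the left need no help from other staircases: either `P`
stays in column `x` and touches it again in row `t + 1`, or row `t` continues left from `x` to `P (t
+ 1)` or past `y`. -/
theorem hasTouch_of_gt {n : ℕ} {K : Finset (Fin n)} {P : ℕ → Fin n} (hP : Antitone P)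
    (hK : ∀ t, P t ∈ K) {x y : Fin n} {t u : ℕ} (htu : t < u) (hyx : y < x) (hy : y ∈ K)
    (hx : x ∈ pathRow K P t) : HasTouch (pathRow K P) x t y u := by
  obtain ⟨h1, h2, h3⟩ := mem_pathRow.1 hx
  rcases h2.eq_or_lt with h | h
  · exact ⟨t + 1, x, by omega, by omega, mem_pathRow.2 ⟨h1, h ▸ hP (by omega), h.ge⟩,
      Set.left_mem_uIcc, by omega, fun h => hyx.ne' h.2⟩
  · rcases le_total y (P (t + 1)) with h' | h'
    · exact ⟨t, P (t + 1), le_rfl, htu.le, mem_pathRow.2 ⟨hK _, le_rfl, hP (by omega)⟩,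
        Set.mem_uIcc.2 (Or.inr ⟨h', h2⟩), fun e => h.ne e.2, by omega⟩
    · exact ⟨t, y, le_rfl, htu.le, mem_pathRow.2 ⟨hy, h', hyx.le.trans h3⟩,
        Set.right_mem_uIcc, fun e => hyx.ne e.2, by omega⟩

/-- A staircase between two others meets the rectangle spanned by a touch to its left and a touch to
its right. -/
theorem hasTouch_of_between {n : ℕ} {K : Finset (Fin n)} {M : ℕ → Fin n} (hM : Antitone M)
    (hK : ∀ t, M t ∈ K) {x y : Fin n} {t u : ℕ} (htu : t < u) (hxK : x ∈ K)
    (hyK : y ∈ K) (hx : x ≤ M t) (hy : M (u + 1) ≤ y) :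
    HasTouch (pathRow K M) x t y u ∨ x ∈ pathRow K M t ∨ y ∈ pathRow K M u := by
  rcases le_or_gt (M (t + 1)) x with h | h
  · exact Or.inr (Or.inl (mem_pathRow.2 ⟨hxK, h, hx⟩))
  rcases le_or_gt (M (t + 1)) y with h' | h'
  · exact Or.inl ⟨t, M (t + 1), le_rfl, htu.le, mem_pathRow.2 ⟨hK _, le_rfl, hM (by omega)⟩,
      Set.mem_uIcc.2 (Or.inl ⟨h.le, h'⟩), fun e => h.ne' e.2, by omega⟩
  have hex : ∃ v, M (v + 1) ≤ y := ⟨u, hy⟩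
  classical
  -- Here `M` is still to the right of `y` after row `t`; `v` is the row in which it reaches column
  -- `y`.
  obtain ⟨v, hv, hmin⟩ : ∃ v, M (v + 1) ≤ y ∧ ∀ w < v, ¬M (w + 1) ≤ y :=
    ⟨Nat.find hex, Nat.find_spec hex, fun w hw => Nat.find_min hex hw⟩
  have hvu : v ≤ u := not_lt.1 fun hlt => hmin u hlt hy
  have htv : t < v := not_le.1 fun hle => absurd (h'.trans_le (hM (by omega))) hv.not_gt
  have hMv : y ≤ M v := by
    have := hmin (v - 1) (by omega)
    rw [Nat.sub_add_cancel (by omega)] at this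
    exact (not_le.1 this).le
  have hmem : y ∈ pathRow K M v := mem_pathRow.2 ⟨hyK, hv, hMv⟩
  rcases hvu.eq_or_lt with rfl | hlt
  · exact Or.inr (Or.inr hmem)
  · exact Or.inl ⟨v, y, htv.le, hvu, hmem, Set.right_mem_uIcc, by omega, by omega⟩

/-- Every rectangle with upper left corner on `P` and lower right corner on `Q` is satisfied. -/
def Linked {n : ℕ} (K : Finset (Fin n)) (P Q : ℕ → Fin n) : Prop :=
  ∀ x y t u, t < u → x < y → x ∈ pathRow K P t → y ∈ pathRow K Q u →
    HasTouch (pathRow K P) x t y u ∨ HasTouch (pathRow K Q) x t y u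

/-- The rows of a union of staircases. -/
def pathsRow {n : ℕ} (K : Finset (Fin n)) (A : ℕ → ℕ → Fin n) (N t : ℕ) : Finset (Fin n) :=
  (Finset.range N).biUnion fun j => pathRow K (A j) t

/-- For an earlier left corner on staircase `i` and a later right corner on staircase `j > i`,
staircase `i + 1` either meets the rectangle or contains one of the corners. If it contains the left
corner, induction on `j - i` applies; if the right one, the link between neighbours does. For `j ≤
i` the order of the staircases excludes such corners. -/
theorem satisfied_pathsRow {n : ℕ} (m : ℕ) (K : Finset (Fin n)) (A : ℕ → ℕ → Fin n) (N : ℕ)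
    (hA : ∀ j, Antitone (A j)) (hK : ∀ j t, A j t ∈ K) (hmono : ∀ t, Monotone fun j => A j t)
    (hlink : ∀ j, Linked K (A j) (A (j + 1))) : Satisfied m (pathsRow K A N) := by
  have hsub : ∀ j < N, ∀ t, pathRow K (A j) t ⊆ pathsRow K A N t := fun j hj t x hx =>
    Finset.mem_biUnion.2 ⟨j, Finset.mem_range.2 hj, hx⟩
  have key : ∀ d i j x y t u, j - i = d → j < N → t < u → x < y → x ∈ pathRow K (A i) t →
      y ∈ pathRow K (A j) u → HasTouch (pathsRow K A N) x t y u := by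
    intro d
    induction d with
    | zero =>
      intro i j x y t u hd hj htu hxy hx hy
      have h1 := (mem_pathRow.1 hx).2.1
      have h2 := (mem_pathRow.1 hy).2.2
      have h3 : A j u ≤ A i u := hmono u (by omega)
      have h4 := hA i (show t + 1 ≤ u by omega)
      exact absurd hxy ((h2.trans (h3.trans (h4.trans h1))).not_gt)
    | succ d ih =>
      intro i j x y t u hd hj htu hxy hx hy
      have link : ∀ y u, t < u → x < y → y ∈ pathRow K (A (i + 1)) u →
          HasTouch (pathsRow K A N) x t y u := by
        intro y u htu hxy hy
        rcases hlink i x y t u htu hxy hx hy with h | h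
        · exact h.mono (hsub i (by omega))
        · exact h.mono (hsub (i + 1) (by omega))
      obtain ⟨x1, x2, x3⟩ := mem_pathRow.1 hx
      obtain ⟨y1, y2, y3⟩ := mem_pathRow.1 hy
      rcases hasTouch_of_between (hA (i + 1)) (hK (i + 1)) htu x1 y1
        (x3.trans (hmono t (Nat.le_succ i)))
        ((hmono (u + 1) (show i + 1 ≤ j by omega)).trans y2) with h | h | h
      · exact h.mono (hsub (i + 1) (by omega))
      · exact ih (i + 1) j x y t u (by omega) hj htu hxy h hy
      · exact link y u htu hxy h
  intro t u htu _ x hx y hy hxy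
  obtain ⟨i, hi, hx⟩ := Finset.mem_biUnion.1 hx
  obtain ⟨j, hj, hy⟩ := Finset.mem_biUnion.1 hy
  rcases hxy.lt_or_gt with h | h
  · exact key _ i j x y t u rfl (Finset.mem_range.1 hj) htu h hx hy
  · exact (hasTouch_of_gt (hA i) (hK i) htu h (mem_pathRow.1 hy).1 hx).mono
      (hsub i (Finset.mem_range.1 hi))

theorem sum_card_pathsRow_le {n : ℕ} (m : ℕ) (K : Finset (Fin n)) (A : ℕ → ℕ → Fin n) (N : ℕ)
    (hA : ∀ j, Antitone (A j)) :
    ∑ t ∈ Finset.range m, (pathsRow K A N t).card ≤ N * (K.card + m) := by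
  calc ∑ t ∈ Finset.range m, (pathsRow K A N t).card
      ≤ ∑ t ∈ Finset.range m, ∑ j ∈ Finset.range N, (pathRow K (A j) t).card :=
        Finset.sum_le_sum fun t _ => Finset.card_biUnion_le
    _ = ∑ j ∈ Finset.range N, ∑ t ∈ Finset.range m, (pathRow K (A j) t).card := Finset.sum_comm
    _ ≤ ∑ _j ∈ Finset.range N, (K.card + m) :=
        Finset.sum_le_sum fun j _ => sum_card_pathRow_le K (A j) (hA j) m
    _ = N * (K.card + m) := by simp

/-! ### Bouncing between two staircases -/

/-- The path between `P` and `Q` that waits until `Q` would pass it and then jumps to `P`. -/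
def bounce {n : ℕ} (P Q : ℕ → Fin n) : ℕ → Fin n
  | 0 => P 0
  | t + 1 => if bounce P Q t ≤ Q (t + 1) then bounce P Q t else P (t + 1)

theorem le_bounce {n : ℕ} {P Q : ℕ → Fin n} (hP : Antitone P) (t : ℕ) : P t ≤ bounce P Q t := by
  induction t with
  | zero => exact le_rfl
  | succ t ih =>
    unfold bounce
    split_ifs
    · exact (hP (Nat.le_succ t)).trans ih
    · exact le_rfl

theorem bounce_le {n : ℕ} {P Q : ℕ → Fin n} (h : ∀ t, P t ≤ Q t) (t : ℕ) : bounce P Q t ≤ Q t := by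
  cases t with
  | zero => exact h 0
  | succ t =>
    unfold bounce
    split_ifs with h'
    · exact h'
    · exact h _

theorem antitone_bounce {n : ℕ} {P Q : ℕ → Fin n} (hP : Antitone P) : Antitone (bounce P Q) := by
  refine antitone_nat_of_succ_le fun t => ?_
  rw [bounce]
  split_ifs
  · exact le_rfl
  · exact (hP (Nat.le_succ t)).trans (le_bounce hP t)

/-- A jump after time `t` lands on `P` at a later time, so at or to the left of `P t`. -/
theorem bounce_eq_or_le {n : ℕ} {P Q : ℕ → Fin n} (hP : Antitone P) {t u : ℕ} (htu : t ≤ u) :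
    bounce P Q u = bounce P Q t ∨ bounce P Q u ≤ P t := by
  induction u, htu using Nat.le_induction with
  | base => exact Or.inl rfl
  | succ u hu ih =>
    rw [bounce]
    split_ifs
    · exact ih
    · exact Or.inr (hP (by omega))

theorem bounce_mem {n : ℕ} {K : Finset (Fin n)} {P Q : ℕ → Fin n} (hK : ∀ t, P t ∈ K) (t : ℕ) :
    bounce P Q t ∈ K := by
  induction t with
  | zero => exact hK 0
  | succ t ih =>
    rw [bounce]
    split_ifs
    exacts [ih, hK _]

/-- If the bounce path jumps in row `u`, it sweeps from `y` or beyond to `P (u + 1) ≤ x` and touches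
`x`. If it waits at `y`, it has been waiting there since row `t`, since a jump in between would have
put it to the left of `y`. -/
theorem linked_bounce_right {n : ℕ} {K : Finset (Fin n)} {P Q : ℕ → Fin n} (hP : Antitone P) :
    Linked K P (bounce P Q) := by
  intro x y t u htu hxy hx hy
  obtain ⟨x1, x2, x3⟩ := mem_pathRow.1 hx
  obtain ⟨y1, y2, y3⟩ := mem_pathRow.1 hy
  right
  by_cases h : bounce P Q u ≤ Q (u + 1)
  · have e : bounce P Q (u + 1) = bounce P Q u := by rw [bounce, if_pos h]
    have hyu : y = bounce P Q u := le_antisymm y3 (e ▸ y2)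
    rcases bounce_eq_or_le (Q := Q) hP (show t + 1 ≤ u by omega) with h' | h'
    · exact ⟨t, y, le_rfl, htu.le, mem_pathRow.2 ⟨y1, by rw [hyu, h'],
        by rw [hyu, h']; exact antitone_bounce hP (Nat.le_succ t)⟩,
        Set.right_mem_uIcc, fun e => hxy.ne' e.2, by omega⟩
    · exact absurd hxy (hyu ▸ h'.trans x2).not_gt
  · have e : bounce P Q (u + 1) = P (u + 1) := by rw [bounce, if_neg h]
    exact ⟨u, x, htu.le, le_rfl, mem_pathRow.2 ⟨x1, e ▸ (hP (by omega)).trans x2, hxy.le.trans y3⟩,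
      Set.left_mem_uIcc, by omega, fun e => hxy.ne e.2⟩

/-- If the bounce path waits at `x` in row `t`, it touches `x` again in row `t + 1`. If it jumps,
`Q` has just passed it, so `y` is to the left of the start of the jump and is swept in row `t`. -/
theorem linked_bounce_left {n : ℕ} {K : Finset (Fin n)} {P Q : ℕ → Fin n} (hP : Antitone P)
    (hQ : Antitone Q) : Linked K (bounce P Q) Q := by
  intro x y t u htu hxy hx hy
  obtain ⟨x1, x2, x3⟩ := mem_pathRow.1 hx
  obtain ⟨y1, y2, y3⟩ := mem_pathRow.1 hy
  left
  by_cases h : bounce P Q t ≤ Q (t + 1)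
  · have e : bounce P Q (t + 1) = bounce P Q t := by rw [bounce, if_pos h]
    have hxt : x = bounce P Q (t + 1) := le_antisymm (e ▸ x3) x2
    exact ⟨t + 1, x, by omega, by omega,
      mem_pathRow.2 ⟨x1, hxt ▸ antitone_bounce hP (Nat.le_succ _), hxt.le⟩,
      Set.left_mem_uIcc, by omega, fun e => hxy.ne e.2⟩
  · have hy' : y ≤ bounce P Q t :=
      y3.trans ((hQ (show t + 1 ≤ u by omega)).trans (not_le.1 h).le)
    exact ⟨t, y, le_rfl, htu.le, mem_pathRow.2 ⟨y1, x2.trans hxy.le, hy'⟩,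
      Set.right_mem_uIcc, fun e => hxy.ne' e.2, by omega⟩

/-- The sequence `P 0, bounce (P 0) (P 1), P 1, bounce (P 1) (P 2), …`. -/
def interleave {n : ℕ} (P : ℕ → ℕ → Fin n) (j : ℕ) : ℕ → Fin n :=
  if j % 2 = 0 then P (j / 2) else bounce (P (j / 2)) (P (j / 2 + 1))

theorem interleave_two_mul {n : ℕ} (P : ℕ → ℕ → Fin n) (i : ℕ) : interleave P (2 * i) = P i := by
  simp [interleave]

theorem interleave_two_mul_add_one {n : ℕ} (P : ℕ → ℕ → Fin n) (i : ℕ) :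
    interleave P (2 * i + 1) = bounce (P i) (P (i + 1)) := by
  have h1 : (2 * i + 1) % 2 = 1 := by omega
  have h2 : (2 * i + 1) / 2 = i := by omega
  simp [interleave, h1, h2]

/-- Between finitely many descending staircases, linearly many further touches make the set
satisfied. -/
theorem satisfied_interleave {n : ℕ} (m : ℕ) (K : Finset (Fin n)) (P : ℕ → ℕ → Fin n) (N : ℕ)
    (hP : ∀ j, Antitone (P j)) (hK : ∀ j t, P j t ∈ K) (hmono : ∀ j t, P j t ≤ P (j + 1) t) :
    Satisfied m (pathsRow K (interleave P) N) := by
  apply satisfied_pathsRow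
  · intro j
    unfold interleave
    split_ifs
    · exact hP _
    · exact antitone_bounce (hP _)
  · intro j t
    unfold interleave
    split_ifs
    · exact hK _ _
    · exact bounce_mem (hK _) t
  · intro t
    refine monotone_nat_of_le_succ fun j => ?_
    rcases Nat.even_or_odd' j with ⟨i, rfl | rfl⟩
    · rw [interleave_two_mul, interleave_two_mul_add_one]
      exact le_bounce (hP _) t
    · rw [interleave_two_mul_add_one, show 2 * i + 1 + 1 = 2 * (i + 1) by ring,
        interleave_two_mul]
      exact bounce_le (hmono i) t
  · intro j
    rcases Nat.even_or_odd' j with ⟨i, rfl | rfl⟩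
    · rw [interleave_two_mul, interleave_two_mul_add_one]
      exact linked_bounce_right (hP _)
    · rw [interleave_two_mul_add_one, show 2 * i + 1 + 1 = 2 * (i + 1) by ring,
        interleave_two_mul]
      exact linked_bounce_left (hP _) (hP _)

theorem antitone_interleave {n : ℕ} (P : ℕ → ℕ → Fin n) (hP : ∀ j, Antitone (P j)) (j : ℕ) :
    Antitone (interleave P j) := by
  unfold interleave
  split_ifs
  · exact hP _
  · exact antitone_bounce (hP _)

/-! ### Patience sorting -/

/-- The position of finger `j` after `t` requests: a request is served by the first finger that is not
to the left of it. All fingers start at the key `w`. -/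
def finger {n m : ℕ} (S : Fin m → Fin n) (w : Fin n) : ℕ → ℕ → Fin n
  | 0, _ => w
  | t + 1, j =>
      if h : t < m then
        if (∀ i < j, finger S w t i < S ⟨t, h⟩) ∧ S ⟨t, h⟩ ≤ finger S w t j then S ⟨t, h⟩
        else finger S w t j
      else finger S w t j

theorem finger_succ_le {n m : ℕ} (S : Fin m → Fin n) (w : Fin n) (t j : ℕ) :
    finger S w (t + 1) j ≤ finger S w t j := by
  rw [finger]
  split_ifs with h h'
  exacts [h'.2, le_rfl, le_rfl]

theorem finger_mono {n m : ℕ} (S : Fin m → Fin n) (w : Fin n) (t : ℕ) :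
    Monotone (finger S w t) := by
  induction t with
  | zero => exact fun _ _ _ => le_rfl
  | succ t ih =>
    refine monotone_nat_of_le_succ fun j => ?_
    rw [finger, finger]
    have h1 := ih (Nat.le_succ j)
    split_ifs with h h2 h3 h3
    · exact le_rfl
    · exact h2.2.trans h1
    · exact (h3.1 j (Nat.lt_succ_self j)).le
    · exact h1
    · exact h1

theorem finger_mem {n m : ℕ} (S : Fin m → Fin n) (w : Fin n) (t j : ℕ) :
    finger S w t j ∈ insert w (Finset.univ.image S) := by
  induction t with
  | zero => simp [finger]
  | succ t ih =>
    rw [finger]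
    split_ifs with h h'
    · simp
    · exact ih
    · exact ih

/-- A finger that has left its initial position witnesses an increasing subsequence. -/
theorem exists_chain_of_finger_lt {n m : ℕ} (S : Fin m → Fin n) (w : Fin n) (hw : ∀ x, x ≤ w)
    (t : ℕ) : ∀ j, finger S w t j < w → ∃ l : List (Fin m), l.length = j + 1 ∧
      l.Pairwise (fun a b => a < b ∧ S a < S b) ∧ (∀ a ∈ l, (a : ℕ) < t) ∧
      ∀ a ∈ l, S a ≤ finger S w t j := by
  induction t with
  | zero => intro j h; exact absurd h (lt_irrefl _)
  | succ t ih =>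
    intro j hj
    by_cases h : t < m
    · by_cases h' : (∀ i < j, finger S w t i < S ⟨t, h⟩) ∧ S ⟨t, h⟩ ≤ finger S w t j
      · have e : finger S w (t + 1) j = S ⟨t, h⟩ := by rw [finger, dif_pos h, if_pos h']
        rw [e]
        cases j with
        | zero => exact ⟨[⟨t, h⟩], rfl, by simp, by simp, by simp⟩
        | succ i =>
          -- Finger `i` is strictly to the left of the request, so it has left `w`; its chain has
          -- smaller values and is extended by the current request.
          have hi := h'.1 i (Nat.lt_succ_self i)
          obtain ⟨l, l1, l2, l3, l4⟩ := ih i (hi.trans_le (hw _))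
          refine ⟨l ++ [⟨t, h⟩], by simp [l1], ?_, ?_, ?_⟩
          · refine List.pairwise_append.2 ⟨l2, by simp, fun a ha b hb => ?_⟩
            rw [List.mem_singleton.1 hb]
            exact ⟨Fin.lt_def.2 (l3 a ha), (l4 a ha).trans_lt hi⟩
          · intro a ha
            rcases List.mem_append.1 ha with ha | ha
            · exact (l3 a ha).trans (Nat.lt_succ_self t)
            · rw [List.mem_singleton.1 ha]; exact Nat.lt_succ_self t
          · intro a ha
            rcases List.mem_append.1 ha with ha | ha
            · exact ((l4 a ha).trans_lt hi).le
            · rw [List.mem_singleton.1 ha]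
      · have e : finger S w (t + 1) j = finger S w t j := by rw [finger, dif_pos h, if_neg h']
        rw [e] at hj ⊢
        obtain ⟨l, l1, l2, l3, l4⟩ := ih j hj
        exact ⟨l, l1, l2, fun a ha => (l3 a ha).trans (Nat.lt_succ_self t), l4⟩
    · have e : finger S w (t + 1) j = finger S w t j := by rw [finger, dif_neg h]
      rw [e] at hj ⊢
      obtain ⟨l, l1, l2, l3, l4⟩ := ih j hj
      exact ⟨l, l1, l2, fun a ha => (l3 a ha).trans (Nat.lt_succ_self t), l4⟩

theorem containsPattern_incPattern_of_chain {n m : ℕ} (S : Fin m → Fin n) (l : List (Fin m))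
    (h : l.Pairwise fun a b => a < b ∧ S a < S b) :
    ContainsPattern S (incPattern l.length) := by
  have hg := List.pairwise_iff_get.1 h
  refine ⟨l.get, fun a b hab => (hg a b hab).1, fun a b => ?_⟩
  have : StrictMono fun a => S (l.get a) := fun a b hab => (hg a b hab).2
  exact this.lt_iff_lt

/-- If `S` has no increasing subsequence of length `k + 1`, then `k` fingers suffice. -/
theorem exists_serving_finger {n m k : ℕ} (hk : 1 ≤ k) (S : Fin m → Fin n) (w : Fin n)
    (hw : ∀ x, x ≤ w) (hS : AvoidsPattern S (incPattern (k + 1))) (t : Fin m) :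
    ∃ j : Fin k, (∀ i < (j : ℕ), finger S w t i < S t) ∧ S t ≤ finger S w t j := by
  have hex : ∃ j, j < k ∧ S t ≤ finger S w t j := by
    by_contra hcon
    push Not at hcon
    have hlt := hcon (k - 1) (by omega)
    obtain ⟨l, l1, l2, l3, l4⟩ :=
      exists_chain_of_finger_lt S w hw t (k - 1) (hlt.trans_le (hw _))
    have hp : (l ++ [t]).Pairwise fun a b => a < b ∧ S a < S b := by
      refine List.pairwise_append.2 ⟨l2, by simp, fun a ha b hb => ?_⟩
      rw [List.mem_singleton.1 hb]
      exact ⟨Fin.lt_def.2 (l3 a ha), (l4 a ha).trans_lt hlt⟩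
    have hc := containsPattern_incPattern_of_chain S _ hp
    have hlen : (l ++ [t]).length = k + 1 := by simp [l1]; omega
    rw [hlen] at hc
    exact hS hc
  classical
  refine ⟨⟨Nat.find hex, (Nat.find_spec hex).1⟩, fun i hi => ?_, (Nat.find_spec hex).2⟩
  have := Nat.find_min hex hi
  have hik := lt_trans hi (Nat.find_spec hex).1
  exact not_le.1 fun h => this ⟨hik, h⟩

/-- A `k`-finger strategy for `S` with small total movement over a set of keys `K`, and a satisfied
set of touches. -/
structure Schedule {n m : ℕ} (k : ℕ) (S : Fin m → Fin n) where
  pos : ℕ → ℕ → Fin n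
  serve : Fin m → Fin k
  keys : Finset (Fin n)
  rows : ℕ → Finset (Fin n)
  pos_succ : ∀ (t : Fin m) (i : Fin k),
    pos (t + 1) i = if serve t = i then S t else pos t i
  pos_mem : ∀ t i, pos t i ∈ keys
  sum_keys_le : ∑ t : Fin m,
    (keys.filter fun x => pos t (serve t) ⊓ S t ≤ x ∧ x ≤ pos t (serve t) ⊔ S t).card ≤ 3 * m * k
  satisfied : Satisfied m rows
  mem_rows : ∀ t : Fin m, S t ∈ rows t
  sum_rows_le : ∑ t ∈ Finset.range m, (rows t).card ≤ 6 * m * k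

/-- The extra key `w` makes the count `2m + 1`, hence the factor 3 and the condition `0 < m`. -/
theorem card_keys_add_le {n m : ℕ} (hm : 0 < m) (S : Fin m → Fin n) (w : Fin n) :
    (insert w (Finset.univ.image S)).card + m ≤ 3 * m := by
  have h1 := Finset.card_insert_le w (Finset.univ.image S)
  have h2 : (Finset.univ.image S).card ≤ m := by
    simpa using Finset.card_image_le (s := Finset.univ) (f := S)
  omega

theorem exists_schedule_of_avoids_inc {n m k : ℕ} (hn : 1 ≤ n) (hk : 1 ≤ k) (S : Fin m → Fin n)
    (hS : AvoidsPattern S (incPattern (k + 1))) : Nonempty (Schedule k S) := by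
  let w : Fin n := ⟨n - 1, by omega⟩
  have hw : ∀ x : Fin n, x ≤ w := fun x => by
    rw [Fin.le_def]; have := x.2; change (x : ℕ) ≤ n - 1; omega
  choose f hf1 hf2 using exists_serving_finger hk S w hw hS
  let K := insert w (Finset.univ.image S)
  let P : ℕ → ℕ → Fin n := fun j t => finger S w t j
  have hP : ∀ j, Antitone (P j) := fun j => antitone_nat_of_succ_le fun t => finger_succ_le S w t j
  have hmoved : ∀ t : Fin m, finger S w (t + 1) (f t) = S t := fun t => by
    rw [finger, dif_pos t.2, if_pos ⟨hf1 t, hf2 t⟩]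
  have hmem : ∀ t : Fin m, S t ∈ pathRow K (P (f t)) t := fun t =>
    mem_pathRow.2 ⟨by simp [K], (hmoved t).le, hf2 t⟩
  have hsum : ∀ N, ∑ t ∈ Finset.range m, (pathsRow K (interleave P) N t).card ≤ N * (3 * m) := by
    intro N
    rcases Nat.eq_zero_or_pos m with rfl | hm
    · simp
    · exact (sum_card_pathsRow_le m K _ N (antitone_interleave P hP)).trans
        (Nat.mul_le_mul_left _ (card_keys_add_le hm S w))
  have hsum' : ∑ t ∈ Finset.range m, (pathsRow K P k t).card ≤ k * (3 * m) := by
    rcases Nat.eq_zero_or_pos m with rfl | hm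
    · simp
    · exact (sum_card_pathsRow_le m K _ k hP).trans
        (Nat.mul_le_mul_left _ (card_keys_add_le hm S w))
  refine ⟨⟨finger S w, f, K, pathsRow K (interleave P) (2 * k), ?_, finger_mem S w, ?_,
    satisfied_interleave m K P _ hP (fun j t => finger_mem S w t j)
      (fun j t => finger_mono S w t (Nat.le_succ j)), ?_, ?_⟩⟩
  · intro t i
    split_ifs with h
    · rw [← h, hmoved]
    · rw [finger, dif_pos t.2, if_neg]
      rintro ⟨h1, h2⟩
      rcases lt_trichotomy (f t : ℕ) i with hlt | heq | hlt
      · exact absurd (h1 _ hlt) (hf2 t).not_gt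
      · exact h (Fin.ext heq)
      · exact absurd (hf1 t _ hlt) (show S t ≤ finger S w t i from h2).not_gt
  · refine le_trans ?_ (hsum'.trans (by ring_nf; exact le_rfl))
    rw [← Fin.sum_univ_eq_sum_range (fun t => (pathsRow K P k t).card)]
    refine Finset.sum_le_sum fun t _ => Finset.card_le_card fun x hx => ?_
    obtain ⟨hx1, hx2⟩ := Finset.mem_filter.1 hx
    rw [inf_eq_right.2 (hf2 t), sup_eq_left.2 (hf2 t)] at hx2
    exact Finset.mem_biUnion.2 ⟨f t, Finset.mem_range.2 (f t).2,
      mem_pathRow.2 ⟨hx1, (hmoved t).trans_le hx2.1, hx2.2⟩⟩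
  · intro t
    -- In `interleave` the fingers have the even indices, and `2k` staircases contain the first `k`
    -- fingers.
    exact Finset.mem_biUnion.2 ⟨2 * f t, Finset.mem_range.2 (by have := (f t).2; omega),
      by rw [interleave_two_mul]; exact hmem t⟩
  · exact (hsum (2 * k)).trans (by ring_nf; exact le_rfl)

theorem rev_mem_uIcc_rev {n : ℕ} {x y z : Fin n} :
    z.rev ∈ Set.uIcc x.rev y.rev ↔ z ∈ Set.uIcc x y := by
  simp only [Set.mem_uIcc, Fin.rev_le_rev]
  tauto

/-- Reflection of the key space. -/
def Schedule.rev {n m k : ℕ} {S : Fin m → Fin n} (h : Schedule k fun t => (S t).rev) :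
    Schedule k S where
  pos t i := (h.pos t i).rev
  serve := h.serve
  keys := h.keys.map Fin.revPerm.toEmbedding
  rows t := (h.rows t).map Fin.revPerm.toEmbedding
  pos_succ t i := by
    rw [h.pos_succ]
    split_ifs <;> simp
  pos_mem t i := by simpa using h.pos_mem t i
  sum_keys_le := by
    refine le_trans (Finset.sum_le_sum fun t _ => ?_) h.sum_keys_le
    rw [← Finset.card_map Fin.revPerm.toEmbedding]
    refine Finset.card_le_card fun x hx => ?_
    simp only [Finset.mem_map_equiv, Finset.mem_filter, Fin.revPerm_symm, Fin.revPerm_apply,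
      Fin.rev_rev] at hx ⊢
    refine ⟨hx.1, ?_⟩
    have hx2 := rev_mem_uIcc_rev.2 (show x.rev ∈ Set.uIcc _ _ from hx.2)
    rw [Fin.rev_rev, Fin.rev_rev] at hx2
    exact hx2
  satisfied := by
    intro t u htu hu x hx y hy hxy
    simp only [Finset.mem_map_equiv, Fin.revPerm_symm, Fin.revPerm_apply] at hx hy
    obtain ⟨v, z, h1, h2, h3, h4, h5, h6⟩ := h.satisfied t u htu hu _ hx _ hy (by simpa using hxy)
    refine ⟨v, z.rev, h1, h2, by simpa using h3, ?_, ?_, ?_⟩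
    · rw [← rev_mem_uIcc_rev]; simpa using h4
    · rintro ⟨e, rfl⟩; exact h5 ⟨e, by simp⟩
    · rintro ⟨e, rfl⟩; exact h6 ⟨e, by simp⟩
  mem_rows t := by simpa using h.mem_rows t
  sum_rows_le := by simpa using h.sum_rows_le

theorem exists_schedule {n m k : ℕ} (hn : 1 ≤ n) (hk : 1 ≤ k) (S : Fin m → Fin n)
    (hS : AvoidsPattern S (incPattern (k + 1)) ∨ AvoidsPattern S (decPattern (k + 1))) :
    Nonempty (Schedule k S) := by
  rcases hS with hS | hS
  · exact exists_schedule_of_avoids_inc hn hk S hS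
  · obtain ⟨h⟩ := exists_schedule_of_avoids_inc hn hk (fun t => (S t).rev) (by
      rintro ⟨g, hg, hpat⟩
      refine hS ⟨g, hg, fun a b => ?_⟩
      have := hpat b a
      simp only [incPattern, Equiv.refl_apply, Fin.rev_lt_rev] at this
      simp only [decPattern, Fin.revPerm_apply, Fin.rev_lt_rev]
      exact this)
    exact ⟨h.rev⟩

/-! ### From satisfied sets to executions -/

/-- As long as the third touch lies in row `t` or `u`, it replaces the corner in that row and the
rectangle gets narrower. The induction is on the width `|x - y|`, written with truncated
subtraction. -/
theorem exists_mem_inter_of_satisfied {n m : ℕ} {X : ℕ → Finset (Fin n)} (hX : Satisfied m X)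
    {t u : ℕ} (htu : t < u) (hu : u < m) : ∀ (d : ℕ) (x y : Fin n),
      ((x : ℕ) - y) + ((y : ℕ) - x) = d → x ∈ X t → y ∈ X u →
      ∃ z ∈ Set.uIcc x y, (∃ v, t < v ∧ v < u ∧ z ∈ X v) ∨ (z ∈ X t ∧ z ∈ X u) := by
  intro d
  induction d using Nat.strong_induction_on with
  | _ d ih =>
  intro x y hd hx hy
  by_cases hxy : x = y
  · exact ⟨x, Set.left_mem_uIcc, Or.inr ⟨hx, hxy ▸ hy⟩⟩
  obtain ⟨v, z, h1, h2, h3, h4, h5, h6⟩ := hX t u htu hu x hx y hy hxy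
  have h4' := Set.mem_uIcc.1 h4
  simp only [Fin.le_def] at h4'
  rcases h1.eq_or_lt with rfl | h1
  · have hzx : (z : ℕ) ≠ x := fun e => h5 ⟨rfl, Fin.ext e⟩
    obtain ⟨z', hz', hz⟩ := ih _ (by omega) z y rfl h3 hy
    exact ⟨z', Set.uIcc_subset_uIcc_right h4 hz', hz⟩
  · rcases h2.eq_or_lt with rfl | h2
    · have hzy : (z : ℕ) ≠ y := fun e => h6 ⟨rfl, Fin.ext e⟩
      obtain ⟨z', hz', hz⟩ := ih _ (by omega) x z rfl hx h3
      exact ⟨z', Set.uIcc_subset_uIcc_left h4 hz', hz⟩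
    · exact ⟨z, h4, Or.inl ⟨v, h1, h2, h3⟩⟩

/-- The first row from `t` on in which `x` is touched, or the number of rows. -/
noncomputable def nextTouch {n : ℕ} (m : ℕ) (X : ℕ → Finset (Fin n)) (t : ℕ) (x : Fin n) : ℕ :=
  sInf {u | t ≤ u ∧ (x ∈ X u ∨ m ≤ u)}

theorem nextTouch_spec {n : ℕ} (m : ℕ) (X : ℕ → Finset (Fin n)) (t : ℕ) (x : Fin n) :
    t ≤ nextTouch m X t x ∧ (x ∈ X (nextTouch m X t x) ∨ m ≤ nextTouch m X t x) :=
  Nat.sInf_mem (s := {u | t ≤ u ∧ (x ∈ X u ∨ m ≤ u)})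
    ⟨max t m, le_max_left _ _, Or.inr (le_max_right _ _)⟩

theorem nextTouch_le {n : ℕ} {m : ℕ} {X : ℕ → Finset (Fin n)} {t u : ℕ} {x : Fin n} (htu : t ≤ u)
    (h : x ∈ X u ∨ m ≤ u) : nextTouch m X t x ≤ u :=
  Nat.sInf_le ⟨htu, h⟩

theorem nextTouch_succ {n : ℕ} {m : ℕ} {X : ℕ → Finset (Fin n)} {t : ℕ} {x : Fin n} (ht : t < m)
    (hx : x ∉ X t) : nextTouch m X (t + 1) x = nextTouch m X t x := by
  obtain ⟨h1, h2⟩ := nextTouch_spec m X t x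
  obtain ⟨h3, h4⟩ := nextTouch_spec m X (t + 1) x
  refine le_antisymm (nextTouch_le ?_ h2) (nextTouch_le (by omega) h4)
  rcases h1.eq_or_lt with h | h
  · rw [← h] at h2
    exact h2.elim (fun h => absurd h hx) (fun h => absurd ht h.not_gt)
  · exact h

/-- One more than the last row before `t` in which `x` is touched, or `0`. -/
def lastTouch {n : ℕ} (X : ℕ → Finset (Fin n)) : ℕ → Fin n → ℕ
  | 0, _ => 0
  | t + 1, x => if x ∈ X t then t + 1 else lastTouch X t x

theorem lastTouch_le {n : ℕ} (X : ℕ → Finset (Fin n)) (t : ℕ) (x : Fin n) :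
    lastTouch X t x ≤ t := by
  induction t with
  | zero => exact le_rfl
  | succ t ih =>
    rw [lastTouch]
    split_ifs <;> omega

/-- Keys that are touched sooner come first; ties are broken in favour of keys that were touched more
recently. -/
noncomputable def priority {n : ℕ} (m : ℕ) (X : ℕ → Finset (Fin n)) (t : ℕ) (x : Fin n) : ℕ ×ₗ ℤ :=
  toLex (nextTouch m X t x, -(lastTouch X t x : ℤ))

/-- Before access `t`, exactly the keys of `X t` have next touch `t`, so they precede all others. -/
theorem exists_priority_lt {n m : ℕ} {X : ℕ → Finset (Fin n)} {t : ℕ} (ht : t < m) :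
    ∀ x ∈ X t, ∀ y ∉ X t, ∃ z ∈ Set.uIcc x y, priority m X t z < priority m X t y := by
  intro x hx y hy
  refine ⟨x, Set.left_mem_uIcc, Prod.Lex.toLex_lt_toLex.2 (Or.inl ?_)⟩
  have h1 := nextTouch_le (m := m) le_rfl (Or.inl hx)
  have h2 := (nextTouch_spec m X (t + 1) y).1
  rw [nextTouch_succ ht hy] at h2
  change nextTouch m X t x < nextTouch m X t y
  omega

/-- This is where satisfaction is used. If `y` is next touched in row `u < m`, some key between `x`
and `y` is touched strictly between rows `t` and `u`, or in both; in the second case it wins a tie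
by recency. If `y` is not touched again, `x` itself precedes it. -/
theorem exists_priority_succ_lt {n m : ℕ} {X : ℕ → Finset (Fin n)} (hX : Satisfied m X) {t : ℕ}
    (ht : t < m) : ∀ x ∈ X t, ∀ y ∉ X t,
      ∃ z ∈ Set.uIcc x y, priority m X (t + 1) z < priority m X (t + 1) y := by
  intro x hx y hy
  obtain ⟨hu, hmem⟩ := nextTouch_spec m X (t + 1) y
  have hlast : ∀ z ∈ X t, lastTouch X (t + 1) y < lastTouch X (t + 1) z := by
    intro z hz
    rw [lastTouch, lastTouch, if_neg hy, if_pos hz]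
    exact Nat.lt_succ_of_le (lastTouch_le X t y)
  have htie : ∀ z ∈ X t, nextTouch m X (t + 1) z ≤ nextTouch m X (t + 1) y →
      priority m X (t + 1) z < priority m X (t + 1) y := by
    intro z hz hle
    rcases hle.eq_or_lt with h | h
    · exact Prod.Lex.toLex_lt_toLex.2 (Or.inr ⟨h, by simpa using hlast z hz⟩)
    · exact Prod.Lex.toLex_lt_toLex.2 (Or.inl h)
  rcases le_or_gt m (nextTouch m X (t + 1) y) with hm | hm
  · exact ⟨x, Set.left_mem_uIcc, htie x hx
      ((nextTouch_le (u := m) (by omega) (Or.inr le_rfl)).trans hm)⟩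
  · obtain ⟨z, hz, h | ⟨h1, h2⟩⟩ := exists_mem_inter_of_satisfied hX
      (t := t) (by omega) hm _ x y rfl hx (hmem.resolve_right hm.not_ge)
    · obtain ⟨v, hv1, hv2, hv3⟩ := h
      exact ⟨z, hz, Prod.Lex.toLex_lt_toLex.2
        (Or.inl ((nextTouch_le (by omega) (Or.inl hv3)).trans_lt hv2))⟩
    · exact ⟨z, hz, htie z h1 (nextTouch_le hu (Or.inl h2))⟩

theorem priority_succ {n m : ℕ} {X : ℕ → Finset (Fin n)} {t : ℕ} (ht : t < m) :
    ∀ x ∉ X t, priority m X t x = priority m X (t + 1) x := by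
  intro x hx
  simp only [priority, nextTouch_succ ht hx, lastTouch, hx, if_false]

theorem OPT_le_of_isExecution {n m : ℕ} {S : Fin m → Fin n} {T : Fin (m + 1) → BinaryTree (Fin n)}
    {c : Fin m → ℕ} (h : IsExecution S T c) : OPT S ≤ ((∑ t : Fin m, c t : ℕ) : ℕ∞) := by
  unfold OPT
  exact (iInf_le _ T).trans ((iInf_le _ c).trans (iInf_le _ h))

/-- A satisfied set of touches that contains the accesses of `S` is turned into an execution of `S`
whose cost is linear in the number of touches. -/
theorem OPT_le_of_satisfied {n m : ℕ} (S : Fin m → Fin n) (X : ℕ → Finset (Fin n))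
    (hX : Satisfied m X) (hS : ∀ t : Fin m, S t ∈ X t) :
    OPT S ≤ ((21 * ∑ t ∈ Finset.range m, (X t).card : ℕ) : ℕ∞) := by
  have h : ∀ t : Fin m, ∃ c ≤ 21 * (X t).card,
      Access (cart (priority m X t) (List.finRange n)) (S t) c
        (cart (priority m X (t + 1)) (List.finRange n)) := fun t =>
    access_cart _ _ (X t) (exists_priority_lt t.2) (exists_priority_succ_lt hX t.2)
      (priority_succ t.2) (S t) (hS t)
  choose c hc hacc using h
  refine (OPT_le_of_isExecution (T := fun t => cart (priority m X t) (List.finRange n))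
    ⟨isBSTOn_cart _, fun t => by simpa using hacc t⟩).trans ?_
  rw [Nat.cast_le, Finset.mul_sum, ← Fin.sum_univ_eq_sum_range (fun t => 21 * (X t).card)]
  exact Finset.sum_le_sum fun t _ => hc t

/-! ### The lazy finger bound -/

theorem treeDist_node_le {α : Type} (a : α) (l r : BinaryTree α) (x y : α) :
    treeDist (.node a l r) x y ≤ treeDist r x y := by
  refine SimpleGraph.edist_anti fun u v h => ?_
  rw [treeGraph, SimpleGraph.fromRel_adj] at h ⊢
  exact ⟨h.1, h.2.imp (fun h => Or.inr (Or.inr h)) fun h => Or.inr (Or.inr h)⟩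

theorem treeDist_root_le_one {α : Type} (a b : α) (l r : BinaryTree α) (hb : IsRoot r b) :
    treeDist (.node a l r) a b ≤ 1 := by
  by_cases hab : a = b
  · subst hab; simp [treeDist]
  · refine le_of_eq (SimpleGraph.edist_eq_one_iff_adj.2 ?_)
    rw [treeGraph, SimpleGraph.fromRel_adj]
    exact ⟨hab, Or.inl hb.isChild_right⟩

/-- The priority that puts the keys of `K` on the right spine. -/
def spinePriority {α : Type} [DecidableEq α] (K : Finset α) (x : α) : ℕ :=
  if x ∈ K then 0 else 1

/-- The root is the first key of `K` and no key of `K` is to its left, so iterating to the right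
puts all of `K` on the right spine. -/
theorem exists_split_first {α : Type} [DecidableEq α] (K : Finset α) (l : List α)
    (h : ∃ x ∈ l, x ∈ K) :
    ∃ l₁ b l₂, l = l₁ ++ b :: l₂ ∧ (∀ x ∈ l₁, x ∉ K) ∧ b ∈ K ∧
      cart (spinePriority K) l =
        .node b (cart (spinePriority K) l₁) (cart (spinePriority K) l₂) := by
  obtain ⟨x, hx, hxK⟩ := h
  obtain ⟨l₁, b, l₂, rfl, h₁, h₂⟩ :=
    exists_split_min (spinePriority K) l (List.ne_nil_of_mem hx)
  have hb : b ∈ K := by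
    by_contra hb
    have hpx : spinePriority K x = 0 := if_pos hxK
    have hpb : spinePriority K b = 1 := if_neg hb
    rcases List.mem_append.1 hx with h | h
    · have := h₁ x h; omega
    · rcases List.mem_cons.1 h with rfl | h
      · exact hb hxK
      · have := h₂ x h; omega
  refine ⟨l₁, b, l₂, rfl, fun y hy hyK => ?_, hb, cart_append_cons _ _ _ _ h₁ h₂⟩
  have := h₁ y hy
  rw [spinePriority, spinePriority, if_pos hb, if_pos hyK] at this
  exact lt_irrefl _ this

/-- Two keys on the spine are at most as far apart as the number of keys of `K` between them. -/
theorem one_add_treeDist_spine_le {α : Type} [LinearOrder α] (K : Finset α) :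
    ∀ (N : ℕ) (l : List α), l.length = N → l.Pairwise (· < ·) → ∀ x ∈ l, ∀ y ∈ l, x ∈ K → y ∈ K →
      x ≤ y → 1 + treeDist (cart (spinePriority K) l) x y ≤
        ((K.filter fun z => x ≤ z ∧ z ≤ y).card : ℕ∞) := by
  intro N
  induction N using Nat.strong_induction_on with
  | _ N ih =>
  intro l hN hl x hx y hy hxK hyK hxy
  obtain ⟨l₁, b, l₂, rfl, h₁, hb, hcart⟩ := exists_split_first K l ⟨x, hx, hxK⟩
  have hsplit : ∀ z ∈ l₁ ++ b :: l₂, z ∈ K → z = b ∨ z ∈ l₂ := by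
    intro z hz hzK
    rcases List.mem_append.1 hz with h | h
    · exact absurd hzK (h₁ z h)
    · exact List.mem_cons.1 h
  have hlen : l₁.length + (l₂.length + 1) = N := by simpa using hN
  obtain ⟨p₁, p₂⟩ := List.pairwise_cons.1 (List.pairwise_append.1 hl).2.1
  have ih₂ := ih l₂.length (by omega) l₂ rfl p₂
  rw [hcart]
  rcases hsplit x hx hxK with rfl | hx₂
  · rcases hsplit y hy hyK with rfl | hy₂
    · have : 1 ≤ (K.filter fun z => y ≤ z ∧ z ≤ y).card :=
        Finset.card_pos.2 ⟨y, by simp [hyK]⟩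
      simpa [treeDist] using this
    -- The next key `a` of `K` is the right child of `x`: one edge is paid for the key `x`, and the
    -- rest of the path runs from `a`.
    · obtain ⟨l₃, a, l₄, rfl, h₃, ha, hcart'⟩ := exists_split_first K l₂ ⟨y, hy₂, hyK⟩
      have hay : a ≤ y := by
        rcases List.mem_append.1 hy₂ with h | h
        · exact absurd hyK (h₃ y h)
        · rcases List.mem_cons.1 h with rfl | h
          · exact le_rfl
          · exact ((List.pairwise_cons.1 (List.pairwise_append.1 p₂).2.1).1 y h).le
      have hxa := p₁ a (by simp)
      have h := ih₂ a (by simp) y hy₂ ha hyK hay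
      have hroot : IsRoot (cart (spinePriority K) (l₃ ++ a :: l₄)) a := by
        rw [hcart']; exact isRoot_node _ _ _
      calc 1 + treeDist (.node x (cart (spinePriority K) l₁)
            (cart (spinePriority K) (l₃ ++ a :: l₄))) x y
          ≤ 1 + (1 + treeDist (cart (spinePriority K) (l₃ ++ a :: l₄)) a y) := by
            gcongr
            exact SimpleGraph.edist_triangle.trans (add_le_add
              (treeDist_root_le_one _ _ _ _ hroot) (treeDist_node_le _ _ _ _ _))
        _ ≤ 1 + ((K.filter fun z => a ≤ z ∧ z ≤ y).card : ℕ∞) := by gcongr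
        _ = ((insert x (K.filter fun z => a ≤ z ∧ z ≤ y)).card : ℕ∞) := by
            rw [Finset.card_insert_of_notMem (by simp [hxa.not_ge])]
            push_cast; ring
        _ ≤ _ := by
            refine Nat.cast_le.2 (Finset.card_le_card fun z hz => ?_)
            rcases Finset.mem_insert.1 hz with rfl | hz
            · simp [hxK, hxy]
            · obtain ⟨z1, z2, z3⟩ := Finset.mem_filter.1 hz
              exact Finset.mem_filter.2 ⟨z1, hxa.le.trans z2, z3⟩
  · have hy₂ : y ∈ l₂ := by
      rcases hsplit y hy hyK with rfl | h
      · exact absurd (p₁ x hx₂) hxy.not_gt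
      · exact h
    exact (add_le_add le_rfl (treeDist_node_le _ _ _ _ _)).trans (ih₂ x hx₂ y hy₂ hxK hyK hxy)

theorem one_add_treeDist_spine_le_uIcc {n : ℕ} (K : Finset (Fin n)) (x y : Fin n) (hx : x ∈ K)
    (hy : y ∈ K) : 1 + treeDist (cart (spinePriority K) (List.finRange n)) y x ≤
      ((K.filter fun z => x ⊓ y ≤ z ∧ z ≤ x ⊔ y).card : ℕ∞) := by
  have h := one_add_treeDist_spine_le K _ (List.finRange n) rfl (List.pairwise_lt_finRange n)
  rcases le_total x y with hxy | hxy
  · rw [inf_eq_left.2 hxy, sup_eq_right.2 hxy, treeDist, SimpleGraph.edist_comm]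
    exact h x (List.mem_finRange x) y (List.mem_finRange y) hx hy hxy
  · rw [inf_eq_right.2 hxy, sup_eq_left.2 hxy]
    exact h y (List.mem_finRange y) x (List.mem_finRange x) hy hx hxy

theorem LF_le_lazyFingerCost {n m k : ℕ} (S : Fin m → Fin n) {T : BinaryTree (Fin n)}
    (hT : IsBSTOn n T) (f : Fin m → Fin k) (ℓ : Fin k → Fin n) :
    LF k S ≤ lazyFingerCost T S f ℓ := by
  unfold LF
  exact (iInf_le _ T).trans ((iInf_le _ hT).trans ((iInf_le _ f).trans (iInf_le _ ℓ)))

theorem Schedule.fingerPos_eq {n m k : ℕ} {S : Fin m → Fin n} (h : Schedule k S) (t : ℕ)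
    (ht : t ≤ m) (i : Fin k) : fingerPos S h.serve (fun i => h.pos 0 i) t i = h.pos t i := by
  induction t with
  | zero => rfl
  | succ t ih =>
    rw [fingerPos, dif_pos (by omega), ih (by omega)]
    exact (h.pos_succ ⟨t, by omega⟩ i).symm

theorem Schedule.apply_mem_keys {n m k : ℕ} {S : Fin m → Fin n} (h : Schedule k S) (t : Fin m) :
    S t ∈ h.keys := by
  have := h.pos_mem (t + 1) (h.serve t)
  rwa [h.pos_succ, if_pos rfl] at this

theorem Schedule.LF_le {n m k : ℕ} {S : Fin m → Fin n} (h : Schedule k S) :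
    LF k S ≤ ((3 * m * k : ℕ) : ℕ∞) := by
  refine (LF_le_lazyFingerCost S (isBSTOn_cart (spinePriority h.keys)) h.serve
    fun i => h.pos 0 i).trans ?_
  refine le_trans ?_ (Nat.cast_le.2 h.sum_keys_le)
  rw [lazyFingerCost, Nat.cast_sum]
  refine Finset.sum_le_sum fun t _ => ?_
  rw [h.fingerPos_eq t t.2.le]
  exact one_add_treeDist_spine_le_uIcc h.keys _ _ (h.pos_mem _ _) (h.apply_mem_keys t)

theorem Schedule.OPT_le {n m k : ℕ} {S : Fin m → Fin n} (h : Schedule k S) :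
    OPT S ≤ ((126 * m * k : ℕ) : ℕ∞) := by
  refine (OPT_le_of_satisfied S h.rows h.satisfied h.mem_rows).trans (Nat.cast_le.2 ?_)
  calc _ ≤ 21 * (6 * m * k) := Nat.mul_le_mul_left _ h.sum_rows_le
    _ = 126 * m * k := by ring

end BSTModel

theorem mainTheorem5 :
    ∃ C : ℝ, 0 < C ∧
      ∀ (n m k : ℕ), 1 ≤ n → 1 ≤ k → ∀ S : Fin m → Fin n,
        (BSTModel.AvoidsPattern S (BSTModel.incPattern (k + 1)) ∨
          BSTModel.AvoidsPattern S (BSTModel.decPattern (k + 1))) →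
        (∃ c : ℕ, BSTModel.LF k S = (c : ℕ∞) ∧ (c : ℝ) ≤ C * ((m : ℝ) * (k : ℝ))) ∧
        (∃ c : ℕ, BSTModel.OPT S = (c : ℕ∞) ∧
          (c : ℝ) ≤ C * ((m : ℝ) * ((k : ℝ) * Real.log ((k : ℝ) + 1)))) := by
  -- `252 = 2 * 126`: the offline bound is `126 * m * k`, and `log (k + 1) ≥ log 2 ≥ 1 / 2`.
  refine ⟨252, by norm_num, fun n m k hn hk S hS => ?_⟩
  obtain ⟨h⟩ := BSTModel.exists_schedule hn hk S hS
  constructor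
  · obtain ⟨c, hc, hcle⟩ := ENat.le_natCast_iff.1 h.LF_le
    refine ⟨c, hc, ?_⟩
    have h1 : (c : ℝ) ≤ 3 * m * k := by exact_mod_cast hcle
    have h2 : (0 : ℝ) ≤ (m : ℝ) * k := by positivity
    linarith
  · obtain ⟨c, hc, hcle⟩ := ENat.le_natCast_iff.1 h.OPT_le
    refine ⟨c, hc, ?_⟩
    have h1 : (c : ℝ) ≤ 126 * m * k := by exact_mod_cast hcle
    have hk' : (1 : ℝ) ≤ k := by exact_mod_cast hk
    have hlog : (1 / 2 : ℝ) ≤ Real.log ((k : ℝ) + 1) :=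
      (by have := Real.log_two_gt_d9; linarith : (1 / 2 : ℝ) ≤ Real.log 2).trans
        (Real.log_le_log (by norm_num) (by linarith))
    calc (c : ℝ) ≤ 252 * ((m : ℝ) * ((k : ℝ) * (1 / 2))) := by linarith
      _ ≤ 252 * ((m : ℝ) * ((k : ℝ) * Real.log ((k : ℝ) + 1))) := by gcongr
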